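/- Let $\eta$ be a Lévy measure concentrated on the integers, i.e. a measure on $\mathbb{Z}$ with $\eta(\{0\})=0$, such that $\sum_{y\in\mathbb{Z}} y^2\eta(\{y\})<\infty$. Let $N$ be a Poisson random measure on $\mathbb{Z}\times[0,1]\times\mathbb{R}$, defined on a probability space $(\Omega,\mathcal F,\mathbb P)$, with intensity measure $\eta\otimes \mathrm{Leb}\otimes \mathrm{Leb}$, and let $L$ be the integer-valued Lévy basis $L(B)=\int y\,\mathbf 1_B(x,s)\,N(dy,dx,ds)$, $B\subseteq[0,1]\times\mathbb{R}$ Borel. Let $d:(-\infty,0]\to[0,1]$ be continuous and increasing (in the weak sense), put $A=\{(x,s)\in[0,1]\times\mathbb{R}: s\le 0,\ 0\le x<d(s)\}$ and assume $\mathrm{Leb}(A)=\int_{-\infty}^0 d(s)\,ds<\infty$. Put $A_t=A+(0,t)$ and define the integer-valued trawl (IVT) process $X_t=L(A_t)$, $t\in\mathbb{R}$. For $m>0$ let $$\alpha_m=\sup\bigl\{|\mathbb P(H\cap G)-\mathbb P(H)\mathbb P(G)| : G\in\sigma(X_t;\,t\le 0),\ H\in\sigma(X_t;\,t\ge m)\bigr\},$$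 and let $\rho(h)=\mathrm{Corr}(X_h,X_0)$, $h\geq 0$, be the autocorrelation function of $X$ (with the convention $\rho=0$ in the degenerate case $\mathrm{Var}(X_0)=0$). Then every $X_t$ is square integrable; if $\eta\ne0$ and $\mathrm{Leb}(A)>0$, then $\mathrm{Corr}(X_{t+h},X_t)=\mathrm{Leb}(A_h\cap A)/\mathrm{Leb}(A)$ for all $t\in\mathbb{R}$ and $h\ge0$; and $X$ is $\alpha$-mixing, that is $\alpha_m\to0$ as $m\to\infty$, with rate $\alpha_m=O(\rho(m))$ as $m\to\infty$. -/

import Mathlib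

open MeasureTheory ProbabilityTheory Filter Topology Asymptotics
open scoped ENNReal

namespace Trawl

noncomputable section

/-- `N` is a Poisson random measure on `E` with intensity (mean) measure `μ`, defined on the
probability space `(Ω, P)`: a random measure such that `N(B)` is Poisson distributed with mean
`μ(B)` (and almost surely infinite if `μ(B) = ∞`), with independent values on disjoint sets. -/
structure IsPoissonRandomMeasure {Ω E : Type*} [MeasurableSpace Ω] [MeasurableSpace E]
    (P : Measure Ω) (N : Ω → Measure E) (μ : Measure E) : Prop where
  measurable : ∀ B : Set E, MeasurableSet B → Measurable fun ω => N ω B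
  law_of_ne_top : ∀ B : Set E, MeasurableSet B → μ B ≠ ∞ →
    P.map (fun ω => N ω B) = (poissonMeasure (μ B).toNNReal).map (fun n : ℕ => (n : ℝ≥0∞))
  law_of_eq_top : ∀ B : Set E, MeasurableSet B → μ B = ∞ → ∀ᵐ ω ∂P, N ω B = ∞
  indep : ∀ (n : ℕ) (B : Fin n → Set E), (∀ i, MeasurableSet (B i)) →
    Pairwise (fun i j => Disjoint (B i) (B j)) → iIndepFun (fun i ω => N ω (B i)) P

/-- The assumption on the Lévy measure `η`, which is concentrated on `ℤ` (so it is a measure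
on `ℤ`): it has no mass at `0` (as every Lévy measure) and `∑ y² η({y}) < ∞`. -/
structure IsSquareSummableLevyMeasure (η : Measure ℤ) : Prop where
  zero : η {0} = 0
  sum_lt_top : ∑' y : ℤ, ENNReal.ofReal ((y : ℝ) ^ 2) * η {y} < ∞

/-- The intensity measure `η ⊗ Leb ⊗ Leb` on `ℤ × [0,1] × ℝ`. -/
def intensity (η : Measure ℤ) : Measure (ℤ × unitInterval × ℝ) :=
  η.prod ((volume : Measure unitInterval).prod (volume : Measure ℝ))

/-- The integer-valued Lévy basis `L(B) = ∫ y 1_B(x, s) N(dy, dx, ds)`, for `B ⊆ [0,1] × ℝ`. -/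
def levyBasis {Ω : Type*} (N : Ω → Measure (ℤ × unitInterval × ℝ))
    (B : Set (unitInterval × ℝ)) (ω : Ω) : ℝ :=
  ∫ p in {p : ℤ × unitInterval × ℝ | p.2 ∈ B}, (p.1 : ℝ) ∂(N ω)

/-- The set `A = {(x, s) : s ≤ 0, 0 ≤ x < d(s)}` in `[0,1] × ℝ`. -/
def baseTrawlSet (d : ℝ → ℝ) : Set (unitInterval × ℝ) :=
  {p | p.2 ≤ 0 ∧ (p.1 : ℝ) < d p.2}

/-- The trawl set `A_t = A + (0, t)`. -/
def trawlSet (d : ℝ → ℝ) (t : ℝ) : Set (unitInterval × ℝ) :=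
  {p | (p.1, p.2 - t) ∈ baseTrawlSet d}

/-- The assumption on the trawl function `d : (-∞, 0] → [0, 1]` (values of `d` at positive
arguments are irrelevant): continuous, increasing, and `Leb(A) < ∞`. -/
structure IsTrawlFunction (d : ℝ → ℝ) : Prop where
  mem_Icc : ∀ s ≤ 0, d s ∈ Set.Icc (0 : ℝ) 1
  continuousOn : ContinuousOn d (Set.Iic 0)
  monotoneOn : MonotoneOn d (Set.Iic 0)
  volume_lt_top : volume (baseTrawlSet d) < ∞

/-- The integer-valued trawl process `X_t = L(A_t)`, `t ∈ ℝ`. -/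
def trawlProcess {Ω : Type*} (N : Ω → Measure (ℤ × unitInterval × ℝ)) (d : ℝ → ℝ)
    (t : ℝ) (ω : Ω) : ℝ :=
  levyBasis N (trawlSet d t) ω

/-- The `σ`-algebra generated by the variables `X_t`, `t ∈ T`. -/
abbrev sigmaGen {Ω : Type*} (X : ℝ → Ω → ℝ) (T : Set ℝ) : MeasurableSpace Ω :=
  ⨆ t ∈ T, MeasurableSpace.comap (X t) inferInstance

/-- The strong mixing coefficients
`α_m = sup {|P(H ∩ G) - P(H) P(G)| : G ∈ σ(X_t, t ≤ 0), H ∈ σ(X_t, t ≥ m)}`. -/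
def alphaCoeff {Ω : Type*} [MeasurableSpace Ω] (P : Measure Ω) (X : ℝ → Ω → ℝ) (m : ℝ) : ℝ :=
  sSup {r : ℝ | ∃ G H : Set Ω, MeasurableSet[sigmaGen X (Set.Iic 0)] G ∧
    MeasurableSet[sigmaGen X (Set.Ici m)] H ∧ r = |P.real (H ∩ G) - P.real H * P.real G|}

/-- A process is `α`-mixing if `α_m → 0` as `m → ∞`. -/
def IsAlphaMixing {Ω : Type*} [MeasurableSpace Ω] (P : Measure Ω) (X : ℝ → Ω → ℝ) : Prop :=
  Tendsto (alphaCoeff P X) atTop (𝓝 0)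

/-- The correlation coefficient of two (square integrable) random variables. -/
def corr {Ω : Type*} [MeasurableSpace Ω] (P : Measure Ω) (Y Z : Ω → ℝ) : ℝ :=
  covariance Y Z P / (√(variance Y P) * √(variance Z P))

/-- The autocorrelation function `ρ(h) = Corr(X_h, X_0)` of a stationary process. -/
def autocorr {Ω : Type*} [MeasurableSpace Ω] (P : Measure Ω) (X : ℝ → Ω → ℝ) (h : ℝ) : ℝ :=
  corr P (X h) (X 0)

end

end Trawl

namespace Trawl

/-! ### Moments of the Poisson distribution -/

section PoissonMoments

/-! Mixing. The variables `X_t`, `t ≤ 0`, depend only on points of `N` with `s ≤ 0`. Since `d` is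
increasing, for `t ≥ m ≥ 0` the set `A_t` meets `{s ≤ 0}` only inside `C = A_m ∩ A`. Deleting `C`
from every trawl set yields a process whose past and future are driven by `N` on disjoint regions,
so they are independent (`indep_genOn`). It agrees with `X` on the event that `N` has no point over
`C`, whose complement has probability at most the mean number of points, `η(ℤ) Leb(C)`. Passing from
one process to the other costs three times this probability, whence `α_m ≤ 3 η(ℤ) Leb(A_m ∩ A)`
(`alphaCoeff_trawlProcess_le`). Here `η(ℤ) < ∞` because `y² ≥ 1` for nonzero integers, and the bound
tends to `0` because `Leb(A) < ∞`.

Correlation. From `E[N(B) N(C)] = μ(B) μ(C) + μ(B ∩ C)`, summed over jump sizes, `Cov(L(B), L(C)) =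
(∑ y² η({y})) Leb(B ∩ C)` (`covariance_levyBasis`). Sums are handled in `ℝ≥0∞`, separately for
positive and negative jumps. Hence `ρ(m) = Leb(A_m ∩ A) / Leb(A)` when `η ≠ 0` and `Leb(A) > 0`,
which turns the mixing bound into `O(ρ(m))`. -/

theorem lintegral_poissonMeasure (r : NNReal) (f : ℕ → ℝ≥0∞) :
    ∫⁻ n, f n ∂(poissonMeasure r) =
      ∑' n : ℕ, ENNReal.ofReal (Real.exp (-r) * r ^ n / n.factorial) * f n := by
  simp [poissonMeasure, lintegral_sum_measure, lintegral_smul_measure]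

/-- The Chen–Stein identity for the Poisson distribution. -/
theorem lintegral_natCast_mul_poissonMeasure (r : NNReal) (g : ℕ → ℝ≥0∞) :
    ∫⁻ n, (n : ℝ≥0∞) * g n ∂(poissonMeasure r) =
      r * ∫⁻ n, g (n + 1) ∂(poissonMeasure r) := by
  -- The term `n = 0` vanishes; afterwards `(n+1) r^(n+1) / (n+1)! = r · r^n / n!` termwise.
  rw [lintegral_poissonMeasure, lintegral_poissonMeasure, tsum_eq_zero_add' ENNReal.summable,
    ← ENNReal.tsum_mul_left]
  simp only [CharP.cast_eq_zero, zero_mul, mul_zero, zero_add]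
  congr with n
  have h1 : ((n + 1 : ℕ) : ℝ≥0∞) = ENNReal.ofReal ((n + 1 : ℕ) : ℝ) := by
    rw [ENNReal.ofReal_natCast]
  have h2 : (r : ℝ≥0∞) = ENNReal.ofReal (r : ℝ) := by simp
  rw [← mul_assoc, ← mul_assoc, h1, h2, ← ENNReal.ofReal_mul (by positivity),
    ← ENNReal.ofReal_mul (by positivity)]
  congr 2
  rw [Nat.factorial_succ, pow_succ]
  push_cast
  field_simp

theorem lintegral_natCast_poissonMeasure (r : NNReal) :
    ∫⁻ n, (n : ℝ≥0∞) ∂(poissonMeasure r) = r := by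
  simpa using lintegral_natCast_mul_poissonMeasure r 1

theorem lintegral_natCast_mul_self_poissonMeasure (r : NNReal) :
    ∫⁻ n, (n : ℝ≥0∞) * n ∂(poissonMeasure r) = r * r + r := by
  rw [lintegral_natCast_mul_poissonMeasure]
  simp only [Nat.cast_add, Nat.cast_one]
  rw [lintegral_add_right _ measurable_const, lintegral_natCast_poissonMeasure]
  simp [mul_add]

end PoissonMoments

/-! ### First and second moments of a Poisson random measure -/

namespace IsPoissonRandomMeasure

variable {Ω E : Type*} [MeasurableSpace Ω] [MeasurableSpace E] {P : Measure Ω}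
  {N : Ω → Measure E} {μ : Measure E}

theorem lintegral_comp (hN : IsPoissonRandomMeasure P N μ) {B : Set E} (hB : MeasurableSet B)
    (hμ : μ B ≠ ∞) {φ : ℝ≥0∞ → ℝ≥0∞} (hφ : Measurable φ) :
    ∫⁻ ω, φ (N ω B) ∂P = ∫⁻ n, φ n ∂(poissonMeasure (μ B).toNNReal) := by
  rw [← lintegral_map hφ (hN.measurable B hB), hN.law_of_ne_top B hB hμ,
    lintegral_map hφ .of_discrete]

theorem lintegral_apply (hN : IsPoissonRandomMeasure P N μ) {B : Set E} (hB : MeasurableSet B)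
    (hμ : μ B ≠ ∞) : ∫⁻ ω, N ω B ∂P = μ B := by
  have := hN.lintegral_comp hB hμ measurable_id
  simp only [id] at this
  simp [this, lintegral_natCast_poissonMeasure, hμ]

theorem lintegral_apply_mul_self (hN : IsPoissonRandomMeasure P N μ) {B : Set E}
    (hB : MeasurableSet B) (hμ : μ B ≠ ∞) :
    ∫⁻ ω, N ω B * N ω B ∂P = μ B * μ B + μ B := by
  rw [hN.lintegral_comp hB hμ (φ := fun x => x * x) (by fun_prop),
    lintegral_natCast_mul_self_poissonMeasure, ENNReal.coe_toNNReal hμ]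

/-- Markov's inequality for a Poisson count: `1_{n ≠ 0} ≤ n` on `ℕ`. -/
theorem measure_ne_zero_le (hN : IsPoissonRandomMeasure P N μ) {B : Set E}
    (hB : MeasurableSet B) : P {ω | N ω B ≠ 0} ≤ μ B := by
  by_cases hμ : μ B = ∞
  · simp [hμ]
  have hm : MeasurableSet ({0}ᶜ : Set ℝ≥0∞) := (measurableSet_singleton 0).compl
  have h := hN.lintegral_comp hB hμ (φ := ({0}ᶜ : Set ℝ≥0∞).indicator 1)
    (measurable_one.indicator hm)
  have h' : ∫⁻ ω, ({0}ᶜ : Set ℝ≥0∞).indicator 1 (N ω B) ∂P = P {ω | N ω B ≠ 0} :=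
    lintegral_indicator_one ((hN.measurable B hB) hm)
  rw [← h', h]
  calc _ ≤ ∫⁻ n : ℕ, (n : ℝ≥0∞) ∂(poissonMeasure (μ B).toNNReal) := by
        refine lintegral_mono fun n => ?_
        rcases n with _ | n
        · simp
        · exact Set.indicator_le_self' (by simp) _ |>.trans (by simp)
    _ = μ B := by rw [lintegral_natCast_poissonMeasure, ENNReal.coe_toNNReal hμ]

theorem iIndepFun_of_pairwise_disjoint (hN : IsPoissonRandomMeasure P N μ) {ι : Type*}
    {B : ι → Set E} (hB : ∀ i, MeasurableSet (B i))
    (hd : Pairwise (fun i j => Disjoint (B i) (B j))) :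
    iIndepFun (fun i ω => N ω (B i)) P := by
  rw [iIndepFun_iff_finset]
  intro s
  have e := s.equivFin
  have := hN.indep s.card (fun k => B (e.symm k)) (fun k => hB _)
    (fun i j hij => hd fun h => hij (e.symm.injective (Subtype.ext h)))
  have h2 := this.precomp e.injective
  simpa [Finset.restrict_def] using h2

theorem indepFun_of_disjoint (hN : IsPoissonRandomMeasure P N μ) {B C : Set E}
    (hB : MeasurableSet B) (hC : MeasurableSet C) (hd : Disjoint B C) :
    IndepFun (fun ω => N ω B) (fun ω => N ω C) P := by
  have := hN.iIndepFun_of_pairwise_disjoint (ι := Bool) (B := fun b => cond b B C)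
    (by rintro (_ | _) <;> simpa) (by rintro (_ | _) (_ | _) h <;> simp_all [disjoint_comm])
  exact this.indepFun (i := true) (j := false) (by simp)

theorem lintegral_apply_mul_of_disjoint (hN : IsPoissonRandomMeasure P N μ) {B C : Set E}
    (hB : MeasurableSet B) (hC : MeasurableSet C) (hd : Disjoint B C) (hμB : μ B ≠ ∞)
    (hμC : μ C ≠ ∞) : ∫⁻ ω, N ω B * N ω C ∂P = μ B * μ C := by
  rw [← hN.lintegral_apply hB hμB, ← hN.lintegral_apply hC hμC]
  exact lintegral_mul_eq_lintegral_mul_lintegral_of_indepFun (hN.measurable B hB)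
    (hN.measurable C hC) (hN.indepFun_of_disjoint hB hC hd)

/-- Split `B` and `C` along `B ∩ C`. Products over disjoint pieces factor by independence; only the
square of `N(B ∩ C)` adds a variance term. -/
theorem lintegral_apply_mul (hN : IsPoissonRandomMeasure P N μ) {B C : Set E}
    (hB : MeasurableSet B) (hC : MeasurableSet C) (hμB : μ B ≠ ∞) (hμC : μ C ≠ ∞) :
    ∫⁻ ω, N ω B * N ω C ∂P = μ B * μ C + μ (B ∩ C) := by
  have hi := hB.inter hC
  have h1 := hB.diff hC
  have h2 := hC.diff hB
  have fi : μ (B ∩ C) ≠ ∞ := measure_ne_top_of_subset Set.inter_subset_left hμB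
  have f1 : μ (B \ C) ≠ ∞ := measure_ne_top_of_subset Set.sdiff_subset hμB
  have f2 : μ (C \ B) ≠ ∞ := measure_ne_top_of_subset Set.sdiff_subset hμC
  have eB : ∀ ν : Measure E, ν B = ν (B ∩ C) + ν (B \ C) :=
    fun ν => (measure_inter_add_sdiff B hC).symm
  have eC : ∀ ν : Measure E, ν C = ν (B ∩ C) + ν (C \ B) :=
    fun ν => by rw [Set.inter_comm]; exact (measure_inter_add_sdiff C hB).symm
  have mi := hN.measurable _ hi
  have m1 := hN.measurable _ h1
  have m2 := hN.measurable _ h2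
  have d1 : Disjoint (B ∩ C) (C \ B) :=
    Set.disjoint_left.2 fun x hx hy => hy.2 hx.1
  have d2 : Disjoint (B \ C) (B ∩ C) :=
    Set.disjoint_left.2 fun x hx hy => hx.2 hy.2
  have d3 : Disjoint (B \ C) (C \ B) :=
    Set.disjoint_left.2 fun x hx hy => hx.2 hy.1
  calc ∫⁻ ω, N ω B * N ω C ∂P
      = ∫⁻ ω, (N ω (B ∩ C) * N ω (B ∩ C) + N ω (B ∩ C) * N ω (C \ B)) +
          (N ω (B \ C) * N ω (B ∩ C) + N ω (B \ C) * N ω (C \ B)) ∂P := by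
        refine lintegral_congr fun ω => ?_
        rw [eB (N ω), eC (N ω)]
        ring
    _ = μ B * μ C + μ (B ∩ C) := by
        rw [lintegral_add_left (by fun_prop), lintegral_add_left (by fun_prop),
          lintegral_add_left (by fun_prop), hN.lintegral_apply_mul_self hi fi,
          hN.lintegral_apply_mul_of_disjoint hi h2 d1 fi f2,
          hN.lintegral_apply_mul_of_disjoint h1 hi d2 f1 fi,
          hN.lintegral_apply_mul_of_disjoint h1 h2 d3 f1 f2, eB μ, eC μ]
        ring

end IsPoissonRandomMeasure

end Trawl

/-! ### Independent scattering at the level of σ-algebras -/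

namespace Trawl

/-- The `σ`-algebra generated by a random measure on measurable subsets of `U`, written as a
directed supremum over countable measurable partitions. -/
abbrev genOn {Ω E : Type*} [MeasurableSpace E] (N : Ω → Measure E) (U : Set E) :
    MeasurableSpace Ω :=
  ⨆ g : {g : E → ℕ // Measurable g}, ⨆ k : ℕ,
    MeasurableSpace.comap (fun ω => N ω (U ∩ g.1 ⁻¹' {k})) inferInstance

theorem measurable_genOn {Ω E : Type*} [MeasurableSpace E] (N : Ω → Measure E) {U B : Set E}
    (hB : MeasurableSet B) (hBU : B ⊆ U) : Measurable[genOn N U] fun ω => N ω B := by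
  classical
  let g : {g : E → ℕ // Measurable g} :=
    ⟨fun x => if x ∈ B then 1 else 0, Measurable.ite hB measurable_const measurable_const⟩
  have hg : U ∩ g.1 ⁻¹' {1} = B := by
    ext x
    by_cases hx : x ∈ B <;> simp [g, hx]
    exact hBU hx
  rw [measurable_iff_comap_le]
  refine le_trans ?_ (le_iSup₂_of_le g 1 le_rfl)
  rw [hg]

/-- Two countable partitions have a common refinement, encoded by `Nat.pair`. A coarse cell is a
countable disjoint union of fine ones, so its mass is a countable sum of theirs. -/
theorem directed_genOn {Ω E : Type*} [MeasurableSpace E] (N : Ω → Measure E) {U : Set E}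
    (hU : MeasurableSet U) :
    Directed (· ≤ ·) fun g : {g : E → ℕ // Measurable g} => ⨆ k : ℕ,
      MeasurableSpace.comap (fun ω => N ω (U ∩ g.1 ⁻¹' {k})) inferInstance := by
  intro g₁ g₂
  let g : {g : E → ℕ // Measurable g} := ⟨fun x => Nat.pair (g₁.1 x) (g₂.1 x),
    (measurable_of_countable fun p : ℕ × ℕ => Nat.pair p.1 p.2).comp (g₁.2.prodMk g₂.2)⟩
  have key : ∀ (h : {g : E → ℕ // Measurable g}) (φ : ℕ → ℕ), (∀ x, h.1 x = φ (g.1 x)) →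
      (⨆ k : ℕ, MeasurableSpace.comap (fun ω => N ω (U ∩ h.1 ⁻¹' {k})) inferInstance) ≤
      ⨆ k : ℕ, MeasurableSpace.comap (fun ω => N ω (U ∩ g.1 ⁻¹' {k})) inferInstance := by
    intro h φ hφ
    refine iSup_le fun k => measurable_iff_comap_le.1 ?_
    have hs : ∀ ω, N ω (U ∩ h.1 ⁻¹' {k}) =
        ∑' j : {j : ℕ // φ j = k}, N ω (U ∩ g.1 ⁻¹' {j.1}) := by
      intro ω
      rw [← measure_iUnion]
      · congr 1
        ext x
        simp [hφ, eq_comm]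
      · intro i j hij
        refine Set.disjoint_left.2 fun x hx hy => hij (Subtype.ext ?_)
        exact hx.2.symm.trans hy.2
      · exact fun j => hU.inter (g.2 (measurableSet_singleton _))
    simp_rw [hs]
    refine @Measurable.tsum Ω _ _ (_) _ _ _ _ _ _ _ _ (.unconditional _) _ _ _ fun j => ?_
    exact measurable_iff_comap_le.2 (le_iSup_of_le j.1 le_rfl)
  exact ⟨g, key g₁ (fun n => n.unpair.1) (by simp [g]), key g₂ (fun n => n.unpair.2) (by simp [g])⟩

namespace IsPoissonRandomMeasure

variable {Ω E : Type*} [MeasurableSpace Ω] [MeasurableSpace E] {P : Measure Ω}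
  {N : Ω → Measure E} {μ : Measure E}

theorem comap_iSup_le (hN : IsPoissonRandomMeasure P N μ) {U : Set E} (hU : MeasurableSet U)
    {g : E → ℕ} (hg : Measurable g) :
    (⨆ k : ℕ, MeasurableSpace.comap (fun ω => N ω (U ∩ g ⁻¹' {k})) inferInstance) ≤
      (inferInstance : MeasurableSpace Ω) :=
  iSup_le fun _ => measurable_iff_comap_le.1 <|
    hN.measurable _ (hU.inter (hg (measurableSet_singleton _)))

theorem genOn_le (hN : IsPoissonRandomMeasure P N μ) {U : Set E} (hU : MeasurableSet U) :
    genOn N U ≤ (inferInstance : MeasurableSpace Ω) :=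
  iSup_le fun g => hN.comap_iSup_le hU g.2

/-- A Poisson random measure is independently scattered. -/
theorem indep_genOn [IsProbabilityMeasure P] (hN : IsPoissonRandomMeasure P N μ) {U V : Set E}
    (hU : MeasurableSet U) (hV : MeasurableSet V) (hd : Disjoint U V) :
    Indep (genOn N U) (genOn N V) P := by
  -- Directedness reduces the claim to one partition of `U` and one of `V`; their cells form a
  -- single disjoint family indexed by `ℕ ⊕ ℕ`.
  refine indep_iSup_of_directed_le (fun g => Indep.symm ?_) (fun g => hN.comap_iSup_le hU g.2)
    (hN.genOn_le hV) (directed_genOn N hU)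
  refine indep_iSup_of_directed_le (fun h => Indep.symm ?_) (fun h => hN.comap_iSup_le hV h.2)
    (hN.comap_iSup_le hU g.2) (directed_genOn N hV)
  let B : ℕ ⊕ ℕ → Set E :=
    Sum.elim (fun k => U ∩ g.1 ⁻¹' {k}) (fun k => V ∩ h.1 ⁻¹' {k})
  have hB : ∀ i, MeasurableSet (B i) := by
    rintro (k | k)
    · exact hU.inter (g.2 (measurableSet_singleton _))
    · exact hV.inter (h.2 (measurableSet_singleton _))
  have hBd : Pairwise fun i j => Disjoint (B i) (B j) := by
    rintro (i | i) (j | j) hij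
    · exact Set.disjoint_left.2 fun x hx hy => hij (congrArg _ (hx.2.symm.trans hy.2))
    · exact hd.mono Set.inter_subset_left Set.inter_subset_left
    · exact hd.symm.mono Set.inter_subset_left Set.inter_subset_left
    · exact Set.disjoint_left.2 fun x hx hy => hij (congrArg _ (hx.2.symm.trans hy.2))
  have hi := (hN.iIndepFun_of_pairwise_disjoint hB hBd).iIndep
  have := indep_iSup_of_disjoint (fun i => measurable_iff_comap_le.1 (hN.measurable _ (hB i))) hi
    (S := Set.range Sum.inl) (T := Set.range Sum.inr) Set.isCompl_range_inl_range_inr.disjoint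
  simpa only [iSup_range, B, Sum.elim_inl, Sum.elim_inr] using this

end IsPoissonRandomMeasure

end Trawl

namespace Trawl

/-! ### The Lévy basis as a function of countably many counts -/

noncomputable section

/-- The integral of `f(y) 1_B(x, s)` with respect to a random measure on `ℤ × [0,1] × ℝ`. -/
def countSum {Ω : Type*} (N : Ω → Measure (ℤ × unitInterval × ℝ)) (f : ℤ → ℝ≥0∞)
    (B : Set (unitInterval × ℝ)) (ω : Ω) : ℝ≥0∞ :=
  ∑' y : ℤ, f y * N ω ({y} ×ˢ B)

theorem measurableSet_snd_mem {B : Set (unitInterval × ℝ)} (hB : MeasurableSet B) :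
    MeasurableSet {p : ℤ × unitInterval × ℝ | p.2 ∈ B} :=
  measurable_snd hB

theorem lintegral_fst_eq_countSum {Ω : Type*} (N : Ω → Measure (ℤ × unitInterval × ℝ))
    (f : ℤ → ℝ≥0∞) (B : Set (unitInterval × ℝ)) (ω : Ω) :
    ∫⁻ p in {p : ℤ × unitInterval × ℝ | p.2 ∈ B}, f p.1 ∂(N ω) = countSum N f B ω := by
  rw [← lintegral_map (f := f) (measurable_of_countable f) measurable_fst, lintegral_countable']
  refine tsum_congr fun y => ?_
  rw [Measure.map_apply measurable_fst (measurableSet_singleton y),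
    Measure.restrict_apply (measurable_fst (measurableSet_singleton y))]
  rfl

/-- The Bochner integral is `0` where it diverges, hence the case split. The formula holds for every
`ω`, so it gives measurability for the uncompleted σ-algebra `genOn`. -/
theorem levyBasis_eq_ite {Ω : Type*} (N : Ω → Measure (ℤ × unitInterval × ℝ))
    (B : Set (unitInterval × ℝ)) (ω : Ω)
    [Decidable (countSum N (fun y => ENNReal.ofReal |(y : ℝ)|) B ω < ∞)] :
    levyBasis N B ω = if countSum N (fun y => ENNReal.ofReal |(y : ℝ)|) B ω < ∞ then
      (countSum N (fun y => ENNReal.ofReal (y : ℝ)) B ω).toReal -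
        (countSum N (fun y => ENNReal.ofReal (-(y : ℝ))) B ω).toReal else 0 := by
  have hm : Measurable fun p : ℤ × unitInterval × ℝ => (p.1 : ℝ) :=
    (measurable_of_countable fun y : ℤ => (y : ℝ)).comp measurable_fst
  have hi : Integrable (fun p : ℤ × unitInterval × ℝ => (p.1 : ℝ))
      ((N ω).restrict {p | p.2 ∈ B}) ↔
      countSum N (fun y => ENNReal.ofReal |(y : ℝ)|) B ω < ∞ := by
    rw [← lintegral_fst_eq_countSum N, Integrable, and_iff_right hm.aestronglyMeasurable,
      hasFiniteIntegral_iff_norm]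
    rfl
  split_ifs with h
  · rw [levyBasis, integral_eq_lintegral_pos_part_sub_lintegral_neg_part (hi.2 h),
      lintegral_fst_eq_countSum N (fun y => ENNReal.ofReal (y : ℝ)),
      lintegral_fst_eq_countSum N (fun y => ENNReal.ofReal (-(y : ℝ)))]
  · exact integral_undef fun h' => h (hi.1 h')

theorem measurable_countSum_genOn {Ω : Type*} (N : Ω → Measure (ℤ × unitInterval × ℝ))
    (f : ℤ → ℝ≥0∞) {U : Set (ℤ × unitInterval × ℝ)} {B : Set (unitInterval × ℝ)}
    (hB : MeasurableSet B) (hBU : ∀ p : ℤ × unitInterval × ℝ, p.2 ∈ B → p ∈ U) :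
    Measurable[genOn N U] (countSum N f B) := by
  refine @Measurable.tsum Ω _ _ (_) _ _ _ _ _ _ _ _ (.unconditional _) _ _ _ fun y => ?_
  refine (measurable_genOn N ((measurableSet_singleton y).prod hB) ?_).const_mul _
  exact fun p hp => hBU p hp.2

theorem measurable_levyBasis_genOn {Ω : Type*} (N : Ω → Measure (ℤ × unitInterval × ℝ))
    {U : Set (ℤ × unitInterval × ℝ)} {B : Set (unitInterval × ℝ)}
    (hB : MeasurableSet B) (hBU : ∀ p : ℤ × unitInterval × ℝ, p.2 ∈ B → p ∈ U) :
    Measurable[genOn N U] (levyBasis N B) := by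
  classical
  have h := fun f => measurable_countSum_genOn N f hB hBU
  have : levyBasis N B = fun ω => _ := funext fun ω => levyBasis_eq_ite N B ω
  rw [this]
  let := genOn N U
  refine Measurable.ite (measurableSet_lt (h _) measurable_const) ?_ measurable_const
  exact (h _).ennreal_toReal.sub (h _).ennreal_toReal

theorem levyBasis_diff_eq {Ω : Type*} (N : Ω → Measure (ℤ × unitInterval × ℝ))
    {B C : Set (unitInterval × ℝ)} {ω : Ω} (h : N ω {p | p.2 ∈ C} = 0) :
    levyBasis N (B \ C) ω = levyBasis N B ω := by
  refine setIntegral_congr_set ?_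
  filter_upwards [measure_eq_zero_iff_ae_notMem.1 h] with p hp
  have hp' : p.2 ∉ C := hp
  exact propext ⟨fun h => h.1, fun h => ⟨h, hp'⟩⟩

/-- The `σ`-algebras generated by two processes that agree on an event `S` have the same trace
on `S`. -/
theorem exists_measurableSet_sigmaGen_inter_eq {Ω : Type*} {X Y : ℝ → Ω → ℝ} {T : Set ℝ}
    {S : Set Ω} (h : ∀ t ∈ T, ∀ ω ∈ S, X t ω = Y t ω) {G : Set Ω}
    (hG : MeasurableSet[sigmaGen X T] G) :
    ∃ G', MeasurableSet[sigmaGen Y T] G' ∧ G ∩ S = G' ∩ S := by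
  -- Pulling back to the subtype `S` commutes with suprema, so the traces are compared generator by
  -- generator.
  have hle : (sigmaGen X T).comap ((↑) : S → Ω) ≤ (sigmaGen Y T).comap ((↑) : S → Ω) := by
    simp only [MeasurableSpace.comap_iSup, MeasurableSpace.comap_comp]
    refine iSup₂_mono fun t ht => le_of_eq ?_
    congr 1
    exact funext fun ω => h t ht ω ω.2
  obtain ⟨G', hG', he⟩ := hle _ ⟨G, hG, rfl⟩
  refine ⟨G', hG', ?_⟩
  have := Subtype.preimage_coe_eq_preimage_coe_iff.1 he
  rw [Set.inter_comm, ← this, Set.inter_comm]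

theorem abs_measureReal_sub_le {Ω : Type*} [MeasurableSpace Ω] {P : Measure Ω}
    [IsProbabilityMeasure P] {G G' S : Set Ω} (h : G ∩ S = G' ∩ S) :
    |P.real G - P.real G'| ≤ P.real Sᶜ := by
  have aux : ∀ {A B : Set Ω}, A ∩ S = B ∩ S → P.real A ≤ P.real B + P.real Sᶜ := by
    intro A B h
    refine (measureReal_mono ?_).trans (measureReal_union_le _ _)
    intro x hx
    by_cases hS : x ∈ S
    · exact Or.inl (h.le ⟨hx, hS⟩).1
    · exact Or.inr hS
  rw [abs_le]
  constructor <;> linarith [aux h, aux h.symm]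

end

end Trawl

/-! ### Geometry of trawl sets and finiteness of the Lévy measure -/

namespace Trawl

noncomputable section

theorem measurableSet_baseTrawlSet {d : ℝ → ℝ} (hd : IsTrawlFunction d) :
    MeasurableSet (baseTrawlSet d) := by
  -- `d` is arbitrary on `(0, ∞)`; freezing it there gives a monotone, hence Borel, function.
  have hm : Monotone fun s => d (min s 0) := fun a b hab =>
    hd.monotoneOn (Set.mem_Iic.2 (min_le_right _ _)) (Set.mem_Iic.2 (min_le_right _ _))
      (min_le_min_right _ hab)
  have h : baseTrawlSet d =
      {p | p.2 ≤ 0} ∩ {p : unitInterval × ℝ | (p.1 : ℝ) < d (min p.2 0)} := by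
    ext p
    refine and_congr_right fun hp => ?_
    have hp' : p.2 ≤ 0 := hp
    simp [min_eq_left hp']
  rw [h]
  exact (measurableSet_le measurable_snd measurable_const).inter
    (measurableSet_lt (measurable_subtype_coe.comp measurable_fst)
      (hm.measurable.comp measurable_snd))

theorem measurePreserving_shift (t : ℝ) :
    MeasurePreserving (fun p : unitInterval × ℝ => (p.1, p.2 - t)) volume volume :=
  (MeasurePreserving.id (volume : Measure unitInterval)).prod
    (measurePreserving_sub_right (volume : Measure ℝ) t)

theorem measurableSet_trawlSet {d : ℝ → ℝ} (hd : IsTrawlFunction d) (t : ℝ) :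
    MeasurableSet (trawlSet d t) :=
  (measurePreserving_shift t).measurable (measurableSet_baseTrawlSet hd)

theorem volume_trawlSet {d : ℝ → ℝ} (hd : IsTrawlFunction d) (t : ℝ) :
    volume (trawlSet d t) = volume (baseTrawlSet d) :=
  (measurePreserving_shift t).measure_preimage (measurableSet_baseTrawlSet hd).nullMeasurableSet

theorem volume_trawlSet_inter {d : ℝ → ℝ} (hd : IsTrawlFunction d) (t h : ℝ) :
    volume (trawlSet d (t + h) ∩ trawlSet d t) = volume (trawlSet d h ∩ baseTrawlSet d) := by
  rw [← (measurePreserving_shift t).measure_preimage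
    ((measurableSet_trawlSet hd h).inter (measurableSet_baseTrawlSet hd)).nullMeasurableSet]
  congr 1
  ext p
  simp [trawlSet, sub_sub]

theorem trawlSet_subset_snd_nonpos (d : ℝ → ℝ) {t : ℝ} (ht : t ≤ 0) :
    trawlSet d t ⊆ {p | p.2 ≤ 0} := fun p hp => by
  have : p.2 - t ≤ 0 := hp.1
  simp only [Set.mem_ofPred_eq]
  linarith

/-- For `s ≤ 0` and `t ≥ m ≥ 0`, `d (s - t)` is at most both `d (s - m)` and `d s`. So one set `C`
captures the overlap of the past with all later trawl sets. -/
theorem trawlSet_inter_snd_nonpos_subset {d : ℝ → ℝ} (hd : IsTrawlFunction d) {m t : ℝ}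
    (hm : 0 ≤ m) (hmt : m ≤ t) :
    trawlSet d t ∩ {p | p.2 ≤ 0} ⊆ trawlSet d m ∩ baseTrawlSet d := by
  rintro ⟨x, s⟩ ⟨⟨-, h2⟩, h3⟩
  simp only [Set.mem_ofPred_eq] at h2 h3
  refine ⟨⟨?_, ?_⟩, h3, ?_⟩
  · simp only; linarith
  · exact h2.trans_le (hd.monotoneOn (by simp only [Set.mem_Iic]; linarith)
      (by simp only [Set.mem_Iic]; linarith) (by linarith))
  · exact h2.trans_le (hd.monotoneOn (by simp only [Set.mem_Iic]; linarith)
      (by simp only [Set.mem_Iic]; linarith) (by simp only; linarith))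

/-- Shifting back by `m` turns the overlap into a tail of the fixed set `A`, which decreases in `m`;
continuity from above then applies. -/
theorem volume_trawlSet_inter_baseTrawlSet {d : ℝ → ℝ} (hd : IsTrawlFunction d) {m : ℝ}
    (hm : 0 ≤ m) :
    volume (trawlSet d m ∩ baseTrawlSet d) = volume (baseTrawlSet d ∩ {p | p.2 ≤ -m}) := by
  rw [← (measurePreserving_shift m).measure_preimage ((measurableSet_baseTrawlSet hd).inter
    (measurableSet_le measurable_snd measurable_const)).nullMeasurableSet]
  congr 1
  have h0 : baseTrawlSet d ⊆ {p | p.2 ≤ 0} := fun p hp => hp.1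
  refine subset_antisymm (fun p hp => ?_) fun p hp => ?_
  · have : p.2 ≤ 0 := h0 hp.2
    exact ⟨hp.1, show p.2 - m ≤ -m by linarith⟩
  · refine trawlSet_inter_snd_nonpos_subset hd hm le_rfl ⟨hp.1, ?_⟩
    have : p.2 - m ≤ -m := hp.2
    simp only [Set.mem_ofPred_eq]
    linarith

theorem tendsto_volume_trawlSet_inter {d : ℝ → ℝ} (hd : IsTrawlFunction d) :
    Tendsto (fun m => volume (trawlSet d m ∩ baseTrawlSet d)) atTop (𝓝 0) := by
  have hm : ∀ m : ℝ, MeasurableSet (baseTrawlSet d ∩ {p | p.2 ≤ -m}) := fun m =>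
    (measurableSet_baseTrawlSet hd).inter (measurableSet_le measurable_snd measurable_const)
  have h := tendsto_measure_iInter_atTop (μ := (volume : Measure (unitInterval × ℝ)))
    (s := fun m : ℝ => baseTrawlSet d ∩ {p | p.2 ≤ -m})
    (fun m => (hm m).nullMeasurableSet)
    (fun a b hab p hp => ⟨hp.1, le_trans hp.2 (neg_le_neg hab)⟩)
    ⟨0, measure_ne_top_of_subset Set.inter_subset_left hd.volume_lt_top.ne⟩
  have he : ⋂ m : ℝ, baseTrawlSet d ∩ {p | p.2 ≤ -m} = ∅ := by
    refine Set.eq_empty_iff_forall_notMem.2 fun p hp => ?_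
    -- At `m = 1 - s` the constraint `s ≤ -m` reads `s ≤ s - 1`.
    have := (Set.mem_iInter.1 hp (1 - p.2)).2
    simp only [Set.mem_ofPred_eq] at this
    linarith
  rw [he, measure_empty] at h
  refine h.congr' ?_
  filter_upwards [eventually_ge_atTop 0] with m hm
  exact (volume_trawlSet_inter_baseTrawlSet hd hm).symm

theorem IsSquareSummableLevyMeasure.tsum_mul_lt_top {η : Measure ℤ}
    (hη : IsSquareSummableLevyMeasure η) {f : ℤ → ℝ≥0∞}
    (hf : ∀ y ≠ 0, f y ≤ ENNReal.ofReal ((y : ℝ) ^ 2)) : ∑' y, f y * η {y} < ∞ := by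
  refine lt_of_le_of_lt (ENNReal.tsum_le_tsum fun y => ?_) hη.sum_lt_top
  rcases eq_or_ne y 0 with rfl | hy
  · simp [hη.zero]
  · gcongr
    exact hf y hy

theorem one_le_sq_of_int_ne_zero {y : ℤ} (hy : y ≠ 0) : (1 : ℝ) ≤ (y : ℝ) ^ 2 := by
  have : 0 < y ^ 2 := by positivity
  exact_mod_cast this

theorem IsSquareSummableLevyMeasure.isFiniteMeasure {η : Measure ℤ}
    (hη : IsSquareSummableLevyMeasure η) : IsFiniteMeasure η := by
  refine ⟨?_⟩
  have h := hη.tsum_mul_lt_top (f := 1) fun y hy => by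
    simpa using one_le_sq_of_int_ne_zero hy
  rw [← lintegral_one, lintegral_countable']
  simpa using h

/-! ### The mixing bound -/

variable {Ω : Type*} [MeasurableSpace Ω] {P : Measure Ω} [IsProbabilityMeasure P] {η : Measure ℤ}
  {N : Ω → Measure (ℤ × unitInterval × ℝ)} {d : ℝ → ℝ}

theorem alphaCoeff_nonneg (P : Measure Ω) (X : ℝ → Ω → ℝ) (m : ℝ) : 0 ≤ alphaCoeff P X m :=
  Real.sSup_nonneg fun _ ⟨_, _, _, _, hr⟩ => hr ▸ abs_nonneg _

/-- Replace `G`, `H` by events of `Y` with the same trace on `S`. The joint probability moves by at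
most `P(Sᶜ)`, the product by twice that. -/
theorem abs_measureReal_inter_sub_mul_le {X : ℝ → Ω → ℝ} {Y : ℝ → Ω → ℝ} {S : Set Ω}
    {T T' : Set ℝ} (hT : ∀ t ∈ T ∪ T', ∀ ω ∈ S, X t ω = Y t ω)
    (hY : Indep (sigmaGen Y T) (sigmaGen Y T') P) {G H : Set Ω}
    (hG : MeasurableSet[sigmaGen X T] G) (hH : MeasurableSet[sigmaGen X T'] H) :
    |P.real (H ∩ G) - P.real H * P.real G| ≤ 3 * P.real Sᶜ := by
  obtain ⟨G', hG', hGG'⟩ := exists_measurableSet_sigmaGen_inter_eq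
    (fun t ht => hT t (Or.inl ht)) hG
  obtain ⟨H', hH', hHH'⟩ := exists_measurableSet_sigmaGen_inter_eq
    (fun t ht => hT t (Or.inr ht)) hH
  have hi : P.real (H' ∩ G') = P.real H' * P.real G' := by
    rw [Set.inter_comm, mul_comm, Measure.real, (Indep_iff _ _ _).1 hY G' H' hG' hH',
      ENNReal.toReal_mul]
    rfl
  have h1 : |P.real (H ∩ G) - P.real (H' ∩ G')| ≤ P.real Sᶜ := by
    refine abs_measureReal_sub_le ?_
    rw [Set.inter_inter_distrib_right, hGG', hHH', ← Set.inter_inter_distrib_right]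
  have h2 := abs_measureReal_sub_le (P := P) hGG'
  have h3 := abs_measureReal_sub_le (P := P) hHH'
  have h4 : |P.real H * P.real G - P.real H' * P.real G'| ≤ 2 * P.real Sᶜ := by
    calc |P.real H * P.real G - P.real H' * P.real G'|
        = |(P.real H - P.real H') * P.real G + P.real H' * (P.real G - P.real G')| := by ring_nf
      _ ≤ |P.real H - P.real H'| * P.real G + P.real H' * |P.real G - P.real G'| := by
          refine (abs_add_le _ _).trans (le_of_eq ?_)
          rw [abs_mul, abs_mul, abs_of_nonneg (measureReal_nonneg (s := G)),
            abs_of_nonneg (measureReal_nonneg (s := H'))]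
      _ ≤ P.real Sᶜ * 1 + 1 * P.real Sᶜ := by
          gcongr <;> exact measureReal_le_one
      _ = 2 * P.real Sᶜ := by ring
  rw [hi] at h1
  rw [abs_le] at *
  constructor <;> linarith [h1.1, h1.2, h4.1, h4.2]

theorem intensity_setOf_snd_mem (hη : IsSquareSummableLevyMeasure η)
    (B : Set (unitInterval × ℝ)) :
    intensity η {p | p.2 ∈ B} = η Set.univ * volume B := by
  have := hη.isFiniteMeasure
  have h : {p : ℤ × unitInterval × ℝ | p.2 ∈ B} = Set.univ ×ˢ B := by ext; simp
  rw [h, intensity, Measure.prod_prod]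
  rfl

theorem alphaCoeff_trawlProcess_le (hη : IsSquareSummableLevyMeasure η)
    (hN : IsPoissonRandomMeasure P N (intensity η)) (hd : IsTrawlFunction d) {m : ℝ}
    (hm : 0 ≤ m) :
    alphaCoeff P (trawlProcess N d) m ≤
      3 * η.real Set.univ * volume.real (trawlSet d m ∩ baseTrawlSet d) := by
  have := hη.isFiniteMeasure
  set C := trawlSet d m ∩ baseTrawlSet d with hC
  have hCm : MeasurableSet C :=
    (measurableSet_trawlSet hd m).inter (measurableSet_baseTrawlSet hd)
  let U : Set (ℤ × unitInterval × ℝ) := {p | p.2.2 ≤ 0} \ {p | p.2 ∈ C}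
  have hU : MeasurableSet U :=
    (measurableSet_le (measurable_snd.comp measurable_snd) measurable_const).diff
      (measurableSet_snd_mem hCm)
  -- With `C` removed, the past of `Y` lives on `U` and its future from `m` on `Uᶜ`: a point of
  -- `A_t`, `t ≥ m`, with `s ≤ 0` would lie in `C`.
  let Y : ℝ → Ω → ℝ := fun t => levyBasis N (trawlSet d t \ C)
  have hY0 : sigmaGen Y (Set.Iic 0) ≤ genOn N U := by
    refine iSup₂_le fun t ht => measurable_iff_comap_le.1 ?_
    refine measurable_levyBasis_genOn N ((measurableSet_trawlSet hd t).diff hCm) fun p hp => ?_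
    exact ⟨trawlSet_subset_snd_nonpos d ht hp.1, hp.2⟩
  have hY1 : sigmaGen Y (Set.Ici m) ≤ genOn N Uᶜ := by
    refine iSup₂_le fun t ht => measurable_iff_comap_le.1 ?_
    refine measurable_levyBasis_genOn N ((measurableSet_trawlSet hd t).diff hCm) fun p hp hpU => ?_
    exact hpU.2 (trawlSet_inter_snd_nonpos_subset hd hm ht ⟨hp.1, hpU.1⟩)
  have hind : Indep (sigmaGen Y (Set.Iic 0)) (sigmaGen Y (Set.Ici m)) P :=
    indep_of_indep_of_le_left (indep_of_indep_of_le_right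
      (hN.indep_genOn hU hU.compl disjoint_compl_right) hY1) hY0
  have hS : P.real {ω | N ω {p | p.2 ∈ C} = 0}ᶜ ≤ η.real Set.univ * volume.real C := by
    have h := hN.measure_ne_zero_le (measurableSet_snd_mem hCm)
    rw [intensity_setOf_snd_mem hη] at h
    refine (ENNReal.toReal_mono ?_ h).trans_eq ENNReal.toReal_mul
    exact ENNReal.mul_ne_top (measure_ne_top _ _)
      (measure_ne_top_of_subset Set.inter_subset_right hd.volume_lt_top.ne)
  refine Real.sSup_le ?_ (by positivity)
  rintro r ⟨G, H, hG, hH, rfl⟩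
  have := abs_measureReal_inter_sub_mul_le (X := trawlProcess N d) (Y := Y)
    (S := {ω | N ω {p | p.2 ∈ C} = 0}) (fun t _ ω hω => (levyBasis_diff_eq N hω).symm) hind hG hH
  linarith

theorem isAlphaMixing_trawlProcess (hη : IsSquareSummableLevyMeasure η)
    (hN : IsPoissonRandomMeasure P N (intensity η)) (hd : IsTrawlFunction d) :
    IsAlphaMixing P (trawlProcess N d) := by
  have h : Tendsto (fun m => 3 * η.real Set.univ *
      volume.real (trawlSet d m ∩ baseTrawlSet d)) atTop (𝓝 0) := by
    simpa [Measure.real] using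
      ((ENNReal.tendsto_toReal ENNReal.zero_ne_top).comp
        (tendsto_volume_trawlSet_inter hd)).const_mul (3 * η.real Set.univ)
  refine tendsto_of_tendsto_of_tendsto_of_le_of_le' tendsto_const_nhds h
    (Eventually.of_forall fun m => alphaCoeff_nonneg _ _ _) ?_
  filter_upwards [eventually_ge_atTop 0] with m hm
  exact alphaCoeff_trawlProcess_le hη hN hd hm

end

end Trawl

/-! ### Covariances of the Lévy basis and the autocorrelation -/

namespace Trawl

noncomputable section

variable {Ω : Type*} [MeasurableSpace Ω] {P : Measure Ω} {η : Measure ℤ}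
  {N : Ω → Measure (ℤ × unitInterval × ℝ)}

theorem intensity_singleton_prod (hη : IsSquareSummableLevyMeasure η) (y : ℤ)
    (B : Set (unitInterval × ℝ)) : intensity η ({y} ×ˢ B) = η {y} * volume B := by
  have := hη.isFiniteMeasure
  rw [intensity, Measure.prod_prod]
  rfl

theorem intensity_singleton_prod_ne_top (hη : IsSquareSummableLevyMeasure η) (y : ℤ)
    {B : Set (unitInterval × ℝ)} (hB : volume B ≠ ∞) : intensity η ({y} ×ˢ B) ≠ ∞ := by
  have := hη.isFiniteMeasure
  rw [intensity_singleton_prod hη]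
  exact ENNReal.mul_ne_top (measure_ne_top _ _) hB

theorem measurable_apply_singleton_prod (hN : IsPoissonRandomMeasure P N (intensity η)) (y : ℤ)
    {B : Set (unitInterval × ℝ)} (hB : MeasurableSet B) :
    Measurable fun ω => N ω ({y} ×ˢ B) :=
  hN.measurable _ ((measurableSet_singleton y).prod hB)

theorem measurable_countSum (hN : IsPoissonRandomMeasure P N (intensity η)) (f : ℤ → ℝ≥0∞)
    {B : Set (unitInterval × ℝ)} (hB : MeasurableSet B) : Measurable (countSum N f B) :=
  Measurable.tsum fun y => (measurable_apply_singleton_prod hN y hB).const_mul _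

theorem lintegral_countSum (hη : IsSquareSummableLevyMeasure η)
    (hN : IsPoissonRandomMeasure P N (intensity η)) (f : ℤ → ℝ≥0∞)
    {B : Set (unitInterval × ℝ)} (hB : MeasurableSet B) (hvB : volume B ≠ ∞) :
    ∫⁻ ω, countSum N f B ω ∂P = (∑' y, f y * η {y}) * volume B := by
  simp only [countSum]
  rw [lintegral_tsum fun y =>
    ((measurable_apply_singleton_prod hN y hB).const_mul _).aemeasurable,
    ← ENNReal.tsum_mul_right]
  refine tsum_congr fun y => ?_
  rw [lintegral_const_mul _ (measurable_apply_singleton_prod hN y hB),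
    hN.lintegral_apply ((measurableSet_singleton y).prod hB)
      (intensity_singleton_prod_ne_top hη y hvB), intensity_singleton_prod hη, mul_assoc]

/-- Expand the product into a double sum over jump sizes. Slabs over distinct jumps are disjoint, so
only the diagonal contributes beyond the product of the means. -/
theorem lintegral_countSum_mul (hη : IsSquareSummableLevyMeasure η)
    (hN : IsPoissonRandomMeasure P N (intensity η)) (f g : ℤ → ℝ≥0∞)
    {B C : Set (unitInterval × ℝ)} (hB : MeasurableSet B) (hC : MeasurableSet C)
    (hvB : volume B ≠ ∞) (hvC : volume C ≠ ∞) :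
    ∫⁻ ω, countSum N f B ω * countSum N g C ω ∂P =
      ((∑' y, f y * η {y}) * volume B) * ((∑' y, g y * η {y}) * volume C) +
        (∑' y, f y * g y * η {y}) * volume (B ∩ C) := by
  have hmB := fun y => measurable_apply_singleton_prod hN y hB
  have hmC := fun y => measurable_apply_singleton_prod hN y hC
  have hyz : ∀ y z : ℤ, ∫⁻ ω, (f y * N ω ({y} ×ˢ B)) * (g z * N ω ({z} ×ˢ C)) ∂P =
      (f y * η {y} * volume B) * (g z * η {z} * volume C) +
        if z = y then f y * g y * η {y} * volume (B ∩ C) else 0 := by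
    intro y z
    have : ∀ ω, (f y * N ω ({y} ×ˢ B)) * (g z * N ω ({z} ×ˢ C)) =
        (f y * g z) * (N ω ({y} ×ˢ B) * N ω ({z} ×ˢ C)) := fun ω => by ring
    simp_rw [this]
    rw [lintegral_const_mul _ ((hmB y).fun_mul (hmC z)),
      hN.lintegral_apply_mul ((measurableSet_singleton y).prod hB)
        ((measurableSet_singleton z).prod hC) (intensity_singleton_prod_ne_top hη y hvB)
        (intensity_singleton_prod_ne_top hη z hvC), Set.prod_inter_prod,
      intensity_singleton_prod hη, intensity_singleton_prod hη]
    split_ifs with h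
    · subst h
      rw [Set.inter_self, intensity_singleton_prod hη]
      ring
    · rw [Set.singleton_inter_eq_empty.2 (by simpa using fun h' => h h'.symm), Set.empty_prod,
        measure_empty]
      ring
  simp only [countSum]
  simp_rw [← ENNReal.tsum_mul_right, ← ENNReal.tsum_mul_left]
  rw [lintegral_tsum fun y => (Measurable.tsum fun z =>
    ((hmB y).const_mul _).fun_mul ((hmC z).const_mul _)).aemeasurable, ← ENNReal.tsum_add]
  refine tsum_congr fun y => ?_
  rw [lintegral_tsum fun z => (((hmB y).const_mul _).fun_mul ((hmC z).const_mul _)).aemeasurable]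
  simp_rw [hyz]
  rw [ENNReal.tsum_add, tsum_ite_eq]

theorem ae_countSum_lt_top (hη : IsSquareSummableLevyMeasure η)
    (hN : IsPoissonRandomMeasure P N (intensity η)) {f : ℤ → ℝ≥0∞}
    (hf : ∑' y, f y * η {y} < ∞)
    {B : Set (unitInterval × ℝ)} (hB : MeasurableSet B) (hvB : volume B ≠ ∞) :
    ∀ᵐ ω ∂P, countSum N f B ω < ∞ := by
  refine ae_lt_top (measurable_countSum hN f hB) ?_
  rw [lintegral_countSum hη hN f hB hvB]
  exact ENNReal.mul_ne_top hf.ne hvB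

theorem covariance_congr_ae {X X' Y Y' : Ω → ℝ} (hX : X =ᵐ[P] X') (hY : Y =ᵐ[P] Y') :
    covariance X Y P = covariance X' Y' P := by
  rw [covariance, covariance, integral_congr_ae hX, integral_congr_ae hY]
  refine integral_congr_ae ?_
  filter_upwards [hX, hY] with ω h1 h2
  rw [h1, h2]

theorem memLp_countSum_toReal (hη : IsSquareSummableLevyMeasure η)
    (hN : IsPoissonRandomMeasure P N (intensity η)) {f : ℤ → ℝ≥0∞}
    (hf : ∑' y, f y * η {y} < ∞) (hff : ∑' y, f y * f y * η {y} < ∞)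
    {B : Set (unitInterval × ℝ)} (hB : MeasurableSet B) (hvB : volume B ≠ ∞) :
    MemLp (fun ω => (countSum N f B ω).toReal) 2 P := by
  have hm := measurable_countSum hN f hB
  rw [memLp_two_iff_integrable_sq hm.ennreal_toReal.aestronglyMeasurable]
  have : (fun ω => (countSum N f B ω).toReal ^ 2) =
      fun ω => (countSum N f B ω * countSum N f B ω).toReal := by
    ext ω
    rw [ENNReal.toReal_mul, sq]
  rw [this]
  refine integrable_toReal_of_lintegral_ne_top (hm.fun_mul hm).aemeasurable ?_
  rw [lintegral_countSum_mul hη hN f f hB hB hvB hvB, Set.inter_self]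
  have h1 := ENNReal.mul_ne_top hf.ne hvB
  exact ENNReal.add_ne_top.2 ⟨ENNReal.mul_ne_top h1 h1, ENNReal.mul_ne_top hff.ne hvB⟩

theorem covariance_countSum_toReal [IsProbabilityMeasure P] (hη : IsSquareSummableLevyMeasure η)
    (hN : IsPoissonRandomMeasure P N (intensity η)) {f g : ℤ → ℝ≥0∞}
    (hf : ∑' y, f y * η {y} < ∞) (hff : ∑' y, f y * f y * η {y} < ∞)
    (hg : ∑' y, g y * η {y} < ∞) (hgg : ∑' y, g y * g y * η {y} < ∞)
    (hfg : ∑' y, f y * g y * η {y} < ∞)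
    {B C : Set (unitInterval × ℝ)} (hB : MeasurableSet B) (hC : MeasurableSet C)
    (hvB : volume B ≠ ∞) (hvC : volume C ≠ ∞) :
    covariance (fun ω => (countSum N f B ω).toReal) (fun ω => (countSum N g C ω).toReal) P =
      (∑' y, f y * g y * η {y}).toReal * volume.real (B ∩ C) := by
  have hmf := measurable_countSum hN f hB
  have hmg := measurable_countSum hN g hC
  have hff' := ae_countSum_lt_top hη hN hf hB hvB
  have hgg' := ae_countSum_lt_top hη hN hg hC hvC
  rw [covariance_eq_sub (memLp_countSum_toReal hη hN hf hff hB hvB)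
    (memLp_countSum_toReal hη hN hg hgg hC hvC), integral_toReal hmf.aemeasurable hff',
    integral_toReal hmg.aemeasurable hgg', lintegral_countSum hη hN f hB hvB,
    lintegral_countSum hη hN g hC hvC]
  have : (fun ω => (countSum N f B ω).toReal) * (fun ω => (countSum N g C ω).toReal) =
      fun ω => (countSum N f B ω * countSum N g C ω).toReal := by
    ext ω
    simp
  rw [this, integral_toReal (hmf.fun_mul hmg).aemeasurable
    (by filter_upwards [hff', hgg'] with ω h1 h2 using ENNReal.mul_lt_top h1 h2)]
  rw [lintegral_countSum_mul hη hN f g hB hC hvB hvC]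
  have h1 := ENNReal.mul_ne_top hf.ne hvB
  have h2 := ENNReal.mul_ne_top hg.ne hvC
  have h3 : volume (B ∩ C) ≠ ∞ := measure_ne_top_of_subset Set.inter_subset_left hvB
  rw [ENNReal.toReal_add (ENNReal.mul_ne_top h1 h2) (ENNReal.mul_ne_top hfg.ne h3)]
  simp only [ENNReal.toReal_mul, Measure.real]
  ring

theorem ofReal_abs_le_ofReal_sq (y : ℤ) :
    ENNReal.ofReal |(y : ℝ)| ≤ ENNReal.ofReal ((y : ℝ) ^ 2) := by
  refine ENNReal.ofReal_le_ofReal ?_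
  rw [← sq_abs]
  rcases eq_or_ne y 0 with rfl | hy
  · simp
  · have : (1 : ℝ) ≤ |(y : ℝ)| := by exact_mod_cast Int.one_le_abs hy
    nlinarith

theorem ofReal_mul_ofReal_le {a b y : ℝ} (ha : a ≤ |y|) (hb : b ≤ |y|) :
    ENNReal.ofReal a * ENNReal.ofReal b ≤ ENNReal.ofReal (y ^ 2) := by
  rw [← sq_abs, sq, ENNReal.ofReal_mul (abs_nonneg y)]
  gcongr

theorem levyBasis_ae_eq (hη : IsSquareSummableLevyMeasure η)
    (hN : IsPoissonRandomMeasure P N (intensity η)) {B : Set (unitInterval × ℝ)}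
    (hB : MeasurableSet B) (hvB : volume B ≠ ∞) :
    levyBasis N B =ᵐ[P] (fun ω => (countSum N (fun y => ENNReal.ofReal (y : ℝ)) B ω).toReal) -
      fun ω => (countSum N (fun y => ENNReal.ofReal (-(y : ℝ))) B ω).toReal := by
  classical
  filter_upwards [ae_countSum_lt_top hη hN
    (hη.tsum_mul_lt_top fun y _ => ofReal_abs_le_ofReal_sq y) hB hvB] with ω hω
  rw [levyBasis_eq_ite N B, if_pos hω]
  rfl

theorem memLp_levyBasis (hη : IsSquareSummableLevyMeasure η)
    (hN : IsPoissonRandomMeasure P N (intensity η)) {B : Set (unitInterval × ℝ)}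
    (hB : MeasurableSet B) (hvB : volume B ≠ ∞) : MemLp (levyBasis N B) 2 P := by
  refine MemLp.ae_eq (levyBasis_ae_eq hη hN hB hvB).symm (MemLp.sub ?_ ?_)
  · exact memLp_countSum_toReal hη hN
      (hη.tsum_mul_lt_top fun y _ => (ENNReal.ofReal_le_ofReal (le_abs_self _)).trans
        (ofReal_abs_le_ofReal_sq y))
      (hη.tsum_mul_lt_top fun y _ => ofReal_mul_ofReal_le (le_abs_self _) (le_abs_self _)) hB hvB
  · exact memLp_countSum_toReal hη hN
      (hη.tsum_mul_lt_top fun y _ => (ENNReal.ofReal_le_ofReal (neg_le_abs _)).trans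
        (ofReal_abs_le_ofReal_sq y))
      (hη.tsum_mul_lt_top fun y _ => ofReal_mul_ofReal_le (neg_le_abs _) (neg_le_abs _)) hB hvB

theorem covariance_levyBasis [IsProbabilityMeasure P] (hη : IsSquareSummableLevyMeasure η)
    (hN : IsPoissonRandomMeasure P N (intensity η)) {B C : Set (unitInterval × ℝ)}
    (hB : MeasurableSet B) (hC : MeasurableSet C) (hvB : volume B ≠ ∞) (hvC : volume C ≠ ∞) :
    covariance (levyBasis N B) (levyBasis N C) P =
      (∑' y : ℤ, ENNReal.ofReal ((y : ℝ) ^ 2) * η {y}).toReal * volume.real (B ∩ C) := by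
  have hp : ∑' y : ℤ, ENNReal.ofReal (y : ℝ) * η {y} < ∞ :=
    hη.tsum_mul_lt_top fun y _ => (ENNReal.ofReal_le_ofReal (le_abs_self _)).trans
      (ofReal_abs_le_ofReal_sq y)
  have hn : ∑' y : ℤ, ENNReal.ofReal (-(y : ℝ)) * η {y} < ∞ :=
    hη.tsum_mul_lt_top fun y _ => (ENNReal.ofReal_le_ofReal (neg_le_abs _)).trans
      (ofReal_abs_le_ofReal_sq y)
  have hpp : ∑' y : ℤ, ENNReal.ofReal (y : ℝ) * ENNReal.ofReal (y : ℝ) * η {y} < ∞ :=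
    hη.tsum_mul_lt_top fun y _ => ofReal_mul_ofReal_le (le_abs_self _) (le_abs_self _)
  have hnn : ∑' y : ℤ, ENNReal.ofReal (-(y : ℝ)) * ENNReal.ofReal (-(y : ℝ)) * η {y} < ∞ :=
    hη.tsum_mul_lt_top fun y _ => ofReal_mul_ofReal_le (neg_le_abs _) (neg_le_abs _)
  -- Since `y⁺ y⁻ = 0`, the cross covariances vanish, and `y² = (y⁺)² + (y⁻)²` recombines the other
  -- two.
  have hpn : ∀ y : ℤ, ENNReal.ofReal (y : ℝ) * ENNReal.ofReal (-(y : ℝ)) = 0 := by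
    intro y
    rcases le_total (y : ℝ) 0 with h | h
    · rw [ENNReal.ofReal_of_nonpos h, zero_mul]
    · rw [ENNReal.ofReal_of_nonpos (neg_nonpos.2 h), mul_zero]
  have hpn' : ∑' y : ℤ, ENNReal.ofReal (y : ℝ) * ENNReal.ofReal (-(y : ℝ)) * η {y} = 0 := by
    simp [hpn]
  have hnp' : ∑' y : ℤ, ENNReal.ofReal (-(y : ℝ)) * ENNReal.ofReal (y : ℝ) * η {y} = 0 := by
    simp_rw [mul_comm (ENNReal.ofReal (-_)), hpn]
    simp
  have hsum : ∑' y : ℤ, ENNReal.ofReal ((y : ℝ) ^ 2) * η {y} =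
      (∑' y : ℤ, ENNReal.ofReal (y : ℝ) * ENNReal.ofReal (y : ℝ) * η {y}) +
        ∑' y : ℤ, ENNReal.ofReal (-(y : ℝ)) * ENNReal.ofReal (-(y : ℝ)) * η {y} := by
    rw [← ENNReal.tsum_add]
    refine tsum_congr fun y => ?_
    rw [← add_mul]
    congr 1
    rcases le_total (y : ℝ) 0 with h | h
    · rw [ENNReal.ofReal_of_nonpos h, ← ENNReal.ofReal_mul (neg_nonneg.2 h), zero_mul, zero_add]
      congr 1
      ring
    · rw [ENNReal.ofReal_of_nonpos (neg_nonpos.2 h), ← ENNReal.ofReal_mul h, zero_mul, add_zero,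
        sq]
  have mp := fun {B : Set (unitInterval × ℝ)} (hB : MeasurableSet B) (hvB : volume B ≠ ∞) =>
    memLp_countSum_toReal hη hN hp hpp hB hvB
  have mn := fun {B : Set (unitInterval × ℝ)} (hB : MeasurableSet B) (hvB : volume B ≠ ∞) =>
    memLp_countSum_toReal hη hN hn hnn hB hvB
  rw [covariance_congr_ae (levyBasis_ae_eq hη hN hB hvB) (levyBasis_ae_eq hη hN hC hvC),
    covariance_sub_sub (mp hB hvB) (mn hB hvB) (mp hC hvC) (mn hC hvC),
    covariance_countSum_toReal hη hN hp hpp hp hpp hpp hB hC hvB hvC,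
    covariance_countSum_toReal hη hN hp hpp hn hnn (by simp [hpn']) hB hC hvB hvC,
    covariance_countSum_toReal hη hN hn hnn hp hpp (by simp [hnp']) hB hC hvB hvC,
    covariance_countSum_toReal hη hN hn hnn hn hnn hnn hB hC hvB hvC, hpn', hnp', hsum,
    ENNReal.toReal_add hpp.ne hnn.ne]
  simp only [ENNReal.toReal_zero]
  ring

theorem IsSquareSummableLevyMeasure.toReal_tsum_pos (hη : IsSquareSummableLevyMeasure η)
    (h0 : η ≠ 0) : 0 < (∑' y : ℤ, ENNReal.ofReal ((y : ℝ) ^ 2) * η {y}).toReal := by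
  refine ENNReal.toReal_pos (fun h => h0 ?_) hη.sum_lt_top.ne
  refine Measure.ext_of_singleton fun y => ?_
  rcases eq_or_ne y 0 with rfl | hy
  · simp [hη.zero]
  · have := (mul_eq_zero.1 (ENNReal.tsum_eq_zero.1 h y)).resolve_left
      (ENNReal.ofReal_pos.2 (one_pos.trans_le (one_le_sq_of_int_ne_zero hy))).ne'
    simpa using this

theorem corr_trawlProcess [IsProbabilityMeasure P] (hη : IsSquareSummableLevyMeasure η)
    (hN : IsPoissonRandomMeasure P N (intensity η)) {d : ℝ → ℝ} (hd : IsTrawlFunction d)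
    (h0 : η ≠ 0) (t h : ℝ) :
    corr P (trawlProcess N d (t + h)) (trawlProcess N d t) =
      volume.real (trawlSet d h ∩ baseTrawlSet d) / volume.real (baseTrawlSet d) := by
  have hm := measurableSet_trawlSet hd
  have hv : ∀ t, volume (trawlSet d t) ≠ ∞ := fun t => by
    rw [volume_trawlSet hd]
    exact hd.volume_lt_top.ne
  have hσ := hη.toReal_tsum_pos h0
  have hvar : ∀ t, variance (trawlProcess N d t) P =
      (∑' y : ℤ, ENNReal.ofReal ((y : ℝ) ^ 2) * η {y}).toReal *
        volume.real (baseTrawlSet d) := by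
    intro t
    have hL := memLp_levyBasis hη hN (hm t) (hv t)
    change variance (levyBasis N (trawlSet d t)) P = _
    rw [← covariance_self hL.aestronglyMeasurable.aemeasurable,
      covariance_levyBasis hη hN (hm t) (hm t) (hv t) (hv t), Set.inter_self, Measure.real,
      volume_trawlSet hd]
    rfl
  have hcov : covariance (trawlProcess N d (t + h)) (trawlProcess N d t) P =
      (∑' y : ℤ, ENNReal.ofReal ((y : ℝ) ^ 2) * η {y}).toReal *
        volume.real (trawlSet d h ∩ baseTrawlSet d) := by
    refine (covariance_levyBasis hη hN (hm _) (hm t) (hv _) (hv t)).trans ?_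
    rw [Measure.real, volume_trawlSet_inter hd]
    rfl
  rw [corr, hcov, hvar, hvar, Real.mul_self_sqrt (by positivity),
    mul_div_mul_left _ _ hσ.ne']

theorem alphaCoeff_isBigO_autocorr [IsProbabilityMeasure P] (hη : IsSquareSummableLevyMeasure η)
    (hN : IsPoissonRandomMeasure P N (intensity η)) {d : ℝ → ℝ} (hd : IsTrawlFunction d) :
    alphaCoeff P (trawlProcess N d) =O[atTop] autocorr P (trawlProcess N d) := by
  -- The factor `Leb(A)` cancels the denominator of `ρ`. If `η = 0` or `Leb(A) = 0`, the bound on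
  -- `α_m` is itself `0`.
  refine IsBigO.of_bound (3 * η.real Set.univ * volume.real (baseTrawlSet d)) ?_
  filter_upwards [eventually_ge_atTop 0] with m hm
  rw [Real.norm_of_nonneg (alphaCoeff_nonneg _ _ _)]
  refine (alphaCoeff_trawlProcess_le hη hN hd hm).trans ?_
  rcases eq_or_ne η 0 with rfl | h0
  · simp
  rcases eq_or_ne (volume.real (baseTrawlSet d)) 0 with hA | hA
  · have : volume.real (trawlSet d m ∩ baseTrawlSet d) ≤ volume.real (baseTrawlSet d) :=
      measureReal_mono Set.inter_subset_right hd.volume_lt_top.ne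
    rw [hA] at this ⊢
    rw [le_antisymm this measureReal_nonneg]
    simp
  · have hc := corr_trawlProcess hη hN hd h0 0 m
    rw [zero_add] at hc
    rw [autocorr, hc, Real.norm_of_nonneg (by positivity), mul_assoc (3 * _),
      mul_div_cancel₀ _ hA]

end

end Trawl

theorem theorem1 {Ω : Type*} [MeasurableSpace Ω] (P : Measure Ω) [IsProbabilityMeasure P]
    (η : Measure ℤ) (hη : Trawl.IsSquareSummableLevyMeasure η)
    (N : Ω → Measure (ℤ × unitInterval × ℝ))
    (hN : Trawl.IsPoissonRandomMeasure P N (Trawl.intensity η))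
    (d : ℝ → ℝ) (hd : Trawl.IsTrawlFunction d) :
    (∀ t : ℝ, MemLp (Trawl.trawlProcess N d t) 2 P) ∧
    (η ≠ 0 → volume (Trawl.baseTrawlSet d) ≠ 0 → ∀ t h : ℝ, 0 ≤ h →
      Trawl.corr P (Trawl.trawlProcess N d (t + h)) (Trawl.trawlProcess N d t) =
        volume.real (Trawl.trawlSet d h ∩ Trawl.baseTrawlSet d) /
          volume.real (Trawl.baseTrawlSet d)) ∧
    Trawl.IsAlphaMixing P (Trawl.trawlProcess N d) ∧
    Trawl.alphaCoeff P (Trawl.trawlProcess N d) =O[atTop]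
      Trawl.autocorr P (Trawl.trawlProcess N d) := by
  refine ⟨fun t => ?_, fun h0 _ t h _ => Trawl.corr_trawlProcess hη hN hd h0 t h,
    Trawl.isAlphaMixing_trawlProcess hη hN hd, Trawl.alphaCoeff_isBigO_autocorr hη hN hd⟩
  refine Trawl.memLp_levyBasis hη hN (Trawl.measurableSet_trawlSet hd t) ?_
  rw [Trawl.volume_trawlSet hd]
  exact hd.volume_lt_top.ne
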